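/- A one-way nondeterministic blind $k$-counter automaton (1N$k$BCA) is a finite automaton with $k$ integer counters, initially $0$. In each move it reads one input symbol or makes an $\varepsilon$-move, and, depending only on its state and on the symbol read (or $\varepsilon$), it nondeterministically chooses a new state and a vector in $\{-1,0,1\}^k$ that is added to the counters. It accepts a word $w$ if some computation that reads all of $w$ ends in an accept state with all counters equal to $0$. A one-way nondeterministic blind homing vector automaton of dimension $d$ with integer matrices (1NBHVA$(d)_{\mathbb{Z}^{d\times d}}$) is a finite automaton with a row vector $v\in\mathbb{Q}^d$, initially $v_0$, and a finite set of matrices in $\mathbb{Z}^{d\times d}$. In each move it reads one input symbol or makes an $\varepsilon$-move, and, depending only on its state and on the symbol read (or $\varepsilon$), it nondeterministically chooses a new state and one of its matrices, by which $v$ is multiplied from the right. It accepts a word $w$ if some computation that reads all of $w$ ends in an accept state with $v=v_0$. For a machine model $A$ let $\mathfrak{L}(A)$ be the class of languages over finite alphabets recognized by machines of type $A$. **Theorem.** $$\bigcup_{k}\mathfrak{L}(\mathrm{1N}k\mathrm{BCA})\subsetneq\mathfrak{L}\bigl(\mathrm{1NBHVA}(3)_{\mathbb{Z}^{3\times 3}}\bigr).$$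 More precisely, the inclusion holds for the languages over every finite alphabet and is strict over every nonempty finite alphabet: for each letter $a$, the language $\{a^{n+2^n}\mid n\ge 0\}$ is not regular, is recognized by a 1NBHVA$(3)_{\mathbb{Z}^{3\times 3}}$, and is not recognized by a 1N$k$BCA for any $k$. -/

import Mathlib

universe u v

/-- `ComputationPath step c w c'`: there is a finite computation from configuration `c` to
configuration `c'` that reads exactly the word `w`. A step is labelled by `some σ` if it reads the symbol `σ`, and by
`none` if it is an `ε`-move, which reads nothing. -/
inductive ComputationPath {α : Type u} {C : Type v} (step : Option α → C → C → Prop) :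
    C → List α → C → Prop
  | nil (c : C) : ComputationPath step c [] c
  | cons {s : Option α} {c c' c'' : C} {w : List α} :
      step s c c' → ComputationPath step c' w c'' → ComputationPath step c (s.toList ++ w) c''

/-- A one-way nondeterministic blind `k`-counter automaton over the alphabet `α` with set of
states `Q`. In each move, each counter is incremented by one of `-1, 0, 1`. -/
structure BlindCounterAutomaton (k : ℕ) (α : Type u) (Q : Type v) where
  /-- initial state -/
  start : Q
  /-- accept states -/
  accept : Set Q
  /-- transition function; `none` stands for `ε` -/
  δ : Q → Option α → Set (Q × (Fin k → SignType))

namespace BlindCounterAutomaton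

variable {k : ℕ} {α : Type u} {Q : Type v}

/-- One move, on configurations `(state, counter values)`. It never depends on the counters. -/
def Step (V : BlindCounterAutomaton k α Q) (s : Option α) (c c' : Q × (Fin k → ℤ)) : Prop :=
  ∃ d : Fin k → SignType, (c'.1, d) ∈ V.δ c.1 s ∧ c'.2 = fun i => c.2 i + (d i : ℤ)

/-- The recognized language: some computation starts in the initial state with all counters `0`,
reads the whole word, and ends in an accept state with all counters `0`. -/
def language (V : BlindCounterAutomaton k α Q) : Language α :=
  {w | ∃ q ∈ V.accept, ComputationPath V.Step (V.start, 0) w (q, 0)}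

end BlindCounterAutomaton

/-- A one-way nondeterministic blind homing vector automaton of dimension `k` over the alphabet `α`
with set of states `Q`. -/
structure BlindHomingVectorAutomaton (k : ℕ) (α : Type u) (Q : Type v) where
  /-- initial state -/
  start : Q
  /-- accept states -/
  accept : Set Q
  /-- initial row vector -/
  init : Fin k → ℚ
  /-- the finite set of matrices of the automaton -/
  matrices : Finset (Matrix (Fin k) (Fin k) ℚ)
  /-- transition function; `none` stands for `ε` -/
  δ : Q → Option α → Set (Q × matrices)

namespace BlindHomingVectorAutomaton

variable {k : ℕ} {α : Type u} {Q : Type v}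

/-- One move, on configurations `(state, vector)`: the row vector is multiplied by a matrix from the
right. It never depends on the vector. -/
def Step (V : BlindHomingVectorAutomaton k α Q) (s : Option α) (c c' : Q × (Fin k → ℚ)) : Prop :=
  ∃ A : V.matrices, (c'.1, A) ∈ V.δ c.1 s ∧ c'.2 = Matrix.vecMul c.2 A.1

/-- The recognized language: some computation starts in the initial state with the initial vector,
reads the whole word, and ends in an accept state with the vector equal to the initial vector. -/
def language (V : BlindHomingVectorAutomaton k α Q) : Language α :=
  {w | ∃ q ∈ V.accept, ComputationPath V.Step (V.start, V.init) w (q, V.init)}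

end BlindHomingVectorAutomaton

/-- The class of languages over `α` recognized by one-way nondeterministic blind `k`-counter
automata (with finitely many states). -/
def blindCounterLanguages (k : ℕ) (α : Type u) : Set (Language α) :=
  {L | ∃ (Q : Type) (_ : Finite Q) (V : BlindCounterAutomaton k α Q), V.language = L}

/-- The class of languages over `α` recognized by `k`-dimensional one-way nondeterministic blind
homing vector automata (with finitely many states) all of whose matrices belong to `M`. -/
def blindHomingVectorLanguages (k : ℕ) (M : Submonoid (Matrix (Fin k) (Fin k) ℚ)) (α : Type u) :
    Set (Language α) :=
  {L | ∃ (Q : Type) (_ : Finite Q) (V : BlindHomingVectorAutomaton k α Q),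
    (∀ A ∈ V.matrices, A ∈ M) ∧ V.language = L}

/-- The multiplicative monoid of `k × k` matrices with integer entries. -/
def integerMatrices (k : ℕ) : Submonoid (Matrix (Fin k) (Fin k) ℚ) :=
  MonoidHom.mrange ((Int.castRingHom ℚ).mapMatrix (m := Fin k)).toMonoidHom

/-- The unary language of all words `a ^ (n + 2 ^ n)`, `n ≥ 0`. -/
def unaryPowLanguage {α : Type u} (a : α) : Language α :=
  {w | ∃ n : ℕ, w = List.replicate (n + 2 ^ n) a}

/-!
Two facts carry the theorem.

*Inclusion.* A blind counter automaton adds vectors to integer counters. Write the vector `c` of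
counters as a difference `a - b` of vectors of natural numbers, where `a` counts the increments and
`b` the decrements, and store `a` and `b` as products of prime powers `∏ pᵢ ^ aᵢ` and `∏ pᵢ ^ bᵢ` in
the first two entries of a row vector of length three whose last entry is `1`. Every move only
multiplies these two entries by integers. The counters are all zero iff the two entries agree
(`primeEncode_injective`), and the linear map `(x, y, z) ↦ (x - y, 0, z)` together with the initial
vector `(0, 0, 1)` turns this into a homing condition
(`BlindCounterAutomaton.language_toHomingVector`).

*Separation.* The vector `(2 ^ n, 0, 1)` is built while reading `n` letters and counted down to
`(1, 0, 1)` by subtracting the last entry, which yields all the words `a ^ (n + 2 ^ n)`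
(`language_doublingAutomaton`). For the negative part, regard the runs of a blind counter automaton
as words over its finite set of transitions. By Higman's lemma, among the accepting runs for
infinitely many words of different lengths there are two with the same final state such that the
first is a subword of the second. The second is then the first with cycles inserted, and since both
have total counter effect zero, so do the inserted cycles together. Repeating all of them `j` times
gives an accepting run for every `j` (`Pumping.IsPath.exists_pump`); hence the lengths of the
accepted words contain an infinite arithmetic progression
(`BlindCounterAutomaton.exists_arithmetic_progression`), while the gaps of `n + 2 ^ n` grow beyond
every bound. Regular languages are recognized without counters, so the language is not regular
either.
-/

/-! ### Computation paths -/

namespace ComputationPath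

variable {α : Type u} {C : Type v} {step : Option α → C → C → Prop}

theorem append {c c' c'' : C} {w w' : List α} (h : ComputationPath step c w c')
    (h' : ComputationPath step c' w' c'') : ComputationPath step c (w ++ w') c'' := by
  induction h with
  | nil => exact h'
  | cons hs _ ih => rw [List.append_assoc]; exact .cons hs (ih h')

theorem single {s : Option α} {c c' : C} (h : step s c c') :
    ComputationPath step c s.toList c' := by
  simpa using ComputationPath.cons h (.nil c')

end ComputationPath

/-! ### Pumping paths in labelled graphs -/

namespace Pumping

variable {Q : Type*} {E : Type*} (src tgt : E → Q)

/-- `IsPath src tgt p l q`: the list `l` of edges is a path from the vertex `p` to the vertex `q` in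
the directed multigraph whose edges `e : E` go from `src e` to `tgt e`. -/
def IsPath : Q → List E → Q → Prop
  | p, [], q => p = q
  | p, e :: l, q => src e = p ∧ IsPath (tgt e) l q

variable {src tgt}

theorem IsPath.append {l : List E} {p q r : Q} {l' : List E} (h : IsPath src tgt p l q)
    (h' : IsPath src tgt q l' r) : IsPath src tgt p (l ++ l') r := by
  induction l generalizing p with
  | nil => cases h; exact h'
  | cons e l ih => exact ⟨h.1, ih h.2⟩

theorem IsPath.repeat {l : List E} {p : Q} (h : IsPath src tgt p l p) (j : ℕ) :
    IsPath src tgt p (List.replicate j l).flatten p := by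
  induction j with
  | zero => rfl
  | succ j ih => simpa [List.replicate_succ] using h.append ih

theorem sum_map_flatten_replicate {M : Type*} [AddCommMonoid M] (wt : E → M) (l : List E) (j : ℕ) :
    ((List.replicate j l).flatten.map wt).sum = j • (l.map wt).sum := by
  simp

/-- The form of `IsPath.exists_pump` that is suited to induction: the longer path may start at
another vertex `p'`, and `u` is its initial segment up to the start of the shorter path. -/
theorem IsPath.exists_pump_aux {M : Type*} [AddCommMonoid M] (wt : E → M) {l l' : List E}
    (hs : l.Sublist l') {p p' q : Q} (h : IsPath src tgt p l q) (h' : IsPath src tgt p' l' q) :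
    ∃ (u : List E) (x : M), IsPath src tgt p' u p ∧
      (l'.map wt).sum = (u.map wt).sum + (l.map wt).sum + x ∧
      ∀ j : ℕ, ∃ l'', IsPath src tgt p l'' q ∧ (l''.map wt).sum = (l.map wt).sum + j • x := by
  induction hs generalizing p p' with
  | slnil => exact ⟨[], 0, by cases h; exact h', by simp, fun j => ⟨[], h, by simp⟩⟩
  | cons e _ ih =>
    obtain ⟨u, x, hu, hx, hj⟩ := ih h h'.2
    exact ⟨e :: u, x, ⟨h'.1, hu⟩, by simp [hx, add_assoc], hj⟩
  | @cons_cons l l' e _ ih =>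
    obtain ⟨u, x, hu, hx, hj⟩ := ih h.2 h'.2
    refine ⟨[], (u.map wt).sum + x, h'.1.symm.trans h.1, ?_, fun j => ?_⟩
    · simp only [List.map_cons, List.sum_cons, hx, List.map_nil, List.sum_nil, zero_add]
      abel
    · obtain ⟨l'', hl'', hw⟩ := hj j
      -- `u` is a cycle at the target of `e`, so it can be repeated right after `e`.
      refine ⟨e :: ((List.replicate j u).flatten ++ l''), ⟨h.1, (hu.repeat j).append hl''⟩, ?_⟩
      simp only [List.map_cons, List.sum_cons, List.map_append, List.sum_append,
        sum_map_flatten_replicate, hw, nsmul_add]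
      abel

/-- If one path is a subword of another path with the same ends, then the longer one arises from the
shorter one by inserting cycles, and these can be repeated any number `j` of times. -/
theorem IsPath.exists_pump {M : Type*} [AddCommMonoid M] (wt : E → M) {l l' : List E}
    (hs : l.Sublist l') {p q : Q} (h : IsPath src tgt p l q) (h' : IsPath src tgt p l' q) :
    ∃ x : M, (l'.map wt).sum = (l.map wt).sum + x ∧
      ∀ j : ℕ, ∃ l'', IsPath src tgt p l'' q ∧ (l''.map wt).sum = (l.map wt).sum + j • x := by
  obtain ⟨u, x, hu, hx, hj⟩ := h.exists_pump_aux wt hs h'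
  refine ⟨(u.map wt).sum + x, by rw [hx]; abel, fun j => ?_⟩
  obtain ⟨l'', hl'', hw⟩ := hj j
  refine ⟨(List.replicate j u).flatten ++ l'', (hu.repeat j).append hl'', ?_⟩
  simp only [List.map_append, List.sum_append, sum_map_flatten_replicate, hw, nsmul_add]
  abel

/-- **Higman's lemma** for the subword order over a finite alphabet. -/
theorem wellQuasiOrdered_sublist (E : Type*) [Finite E] :
    WellQuasiOrdered (fun l l' : List E => l.Sublist l') := by
  intro f
  have h := Set.PartiallyWellOrderedOn.partiallyWellOrderedOn_sublistForall₂ (Eq : E → E → Prop)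
    (s := Set.univ) Set.finite_univ.partiallyWellOrderedOn
  obtain ⟨m, n, hmn, hf⟩ := h.exists_lt (f := f) (by simp)
  obtain ⟨l, hl, hs⟩ := List.sublistForall₂_iff.1 hf
  rw [List.forall₂_eq_eq_eq] at hl
  exact ⟨m, n, hmn, hl ▸ hs⟩

end Pumping

/-! ### Lengths of words accepted by blind counter automata -/

namespace BlindCounterAutomaton

open Pumping

variable {k : ℕ} {α : Type u} {Q : Type v} (V : BlindCounterAutomaton k α Q)

/-- The transitions of the automaton. -/
abbrev Edge : Type (max u v) :=
  {e : Q × Option α × Q × (Fin k → SignType) // e.2.2 ∈ V.δ e.1 e.2.1}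

/-- The change of the counters in a transition, and the number of letters read. -/
def edgeWeight (e : V.Edge) : (Fin k → ℤ) × ℕ :=
  (fun i => (e.1.2.2.2 i : ℤ), e.1.2.1.toList.length)

/-- Paths in the transition graph. -/
abbrev EdgePath : Q → List V.Edge → Q → Prop :=
  IsPath (fun e : V.Edge => e.1.1) (fun e => e.1.2.2.1)

theorem exists_edgePath {x y : Q × (Fin k → ℤ)} {w : List α}
    (h : ComputationPath V.Step x w y) :
    ∃ l, V.EdgePath x.1 l y.1 ∧ x.2 + (l.map V.edgeWeight).sum.1 = y.2 ∧
      (l.map V.edgeWeight).sum.2 = w.length := by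
  induction h with
  | nil c => exact ⟨[], rfl, by simp, by simp⟩
  | @cons s c c' c'' w hs _ ih =>
    obtain ⟨d, hd, hc⟩ := hs
    obtain ⟨l, hl, h1, h2⟩ := ih
    refine ⟨⟨(c.1, s, c'.1, d), hd⟩ :: l, ⟨rfl, hl⟩, ?_, ?_⟩
    · rw [← h1, hc]
      ext i
      simp [edgeWeight, add_assoc]
    · simp [edgeWeight, h2]

theorem EdgePath.exists_computationPath {l : List V.Edge} {p q : Q} (h : V.EdgePath p l q)
    (c : Fin k → ℤ) :
    ∃ w, ComputationPath V.Step (p, c) w (q, c + (l.map V.edgeWeight).sum.1) ∧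
      w.length = (l.map V.edgeWeight).sum.2 := by
  induction l generalizing p c with
  | nil => cases h; exact ⟨[], by simpa using ComputationPath.nil _, by simp⟩
  | cons e l ih =>
    obtain ⟨rfl, h⟩ := h
    obtain ⟨w, hw, hlen⟩ := ih h (c + (V.edgeWeight e).1)
    refine ⟨e.1.2.1.toList ++ w, .cons (c' := (e.1.2.2.1, c + (V.edgeWeight e).1))
      ⟨e.1.2.2.2, e.2, rfl⟩ ?_, by simp [hlen, edgeWeight]⟩
    simpa [add_assoc] using hw

/-- A blind counter automaton that accepts words of infinitely many lengths accepts words of all the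
lengths in some infinite arithmetic progression. -/
theorem exists_arithmetic_progression [Finite α] [Finite Q] (f : ℕ → List α)
    (hf : StrictMono fun n => (f n).length) (hV : ∀ n, f n ∈ V.language) :
    ∃ N d : ℕ, 0 < d ∧ ∀ j : ℕ, ∃ w ∈ V.language, w.length = N + j * d := by
  choose q hq hpath using hV
  choose l hl hsum hlen using fun n => V.exists_edgePath (hpath n)
  obtain ⟨m, n, hmn, hqmn, hsub⟩ :=
    ((Finite.wellQuasiOrdered (Eq : Q → Q → Prop)).prod
      (wellQuasiOrdered_sublist V.Edge)) fun n => (q n, l n)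
  dsimp only at hqmn hsub
  have hln := hl n
  rw [← hqmn] at hln
  obtain ⟨x, hx, hj⟩ := (hl m).exists_pump V.edgeWeight hsub hln
  have hm1 := hsum m
  have hn1 := hsum n
  simp only [zero_add] at hm1 hn1
  have hx1 : x.1 = 0 := by
    have := congrArg Prod.fst hx
    simpa [hm1, hn1] using this.symm
  have hx2 : (f n).length = (f m).length + x.2 := by
    rw [← hlen n, ← hlen m, hx]; rfl
  refine ⟨(f m).length, x.2, ?_, fun j => ?_⟩
  · have := hf hmn
    dsimp only at this
    omega
  · obtain ⟨l'', hl'', hw⟩ := hj j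
    obtain ⟨w, hw1, hw2⟩ := EdgePath.exists_computationPath V hl'' 0
    refine ⟨w, ⟨q m, hq m, ?_⟩, ?_⟩
    · simpa [hw, hm1, hx1] using hw1
    · rw [hw2, hw, ← hlen m]; simp

end BlindCounterAutomaton

theorem not_forall_exists_add_two_pow_eq (N d : ℕ) (hd : 0 < d) :
    ¬ ∀ j : ℕ, ∃ n : ℕ, n + 2 ^ n = N + j * d := by
  intro h
  have hmono : StrictMono fun n : ℕ => n + 2 ^ n :=
    strictMono_id.add (pow_right_strictMono₀ one_lt_two)
  -- `j` is so large that the value at the index `n` found for it is followed by a gap above `d`.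
  obtain ⟨n, hn⟩ := h (d + 2 ^ d)
  obtain ⟨m, hm⟩ := h (d + 2 ^ d + 1)
  have hdn : d ≤ n := by
    rw [← hmono.le_iff_le, hn]
    exact (Nat.le_mul_of_pos_right _ hd).trans (Nat.le_add_left _ _)
  have hnm : n + 1 ≤ m := by
    rw [Nat.succ_le_iff, ← hmono.lt_iff_lt, hn, hm]
    nlinarith
  have h1 : n + 1 + 2 ^ (n + 1) ≤ m + 2 ^ m := hmono.le_iff_le.2 hnm
  have h2 : n < 2 ^ n := Nat.lt_two_pow_self
  rw [pow_succ] at h1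
  rw [add_mul, one_mul] at hm
  omega

theorem unaryPowLanguage_notMem_blindCounterLanguages {α : Type u} [Finite α] (a : α) (k : ℕ) :
    unaryPowLanguage a ∉ blindCounterLanguages k α := by
  rintro ⟨Q, _, V, hV⟩
  obtain ⟨N, d, hd, h⟩ := V.exists_arithmetic_progression
    (fun n => List.replicate (n + 2 ^ n) a)
    (by simpa using strictMono_id.add (pow_right_strictMono₀ (one_lt_two (α := ℕ))))
    (fun n => by rw [hV]; exact ⟨n, rfl⟩)
  refine not_forall_exists_add_two_pow_eq N d hd fun j => ?_
  obtain ⟨w, hw, hlen⟩ := h j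
  rw [hV] at hw
  obtain ⟨n, rfl⟩ := hw
  exact ⟨n, by simpa using hlen⟩

/-! ### Regular languages -/

/-- A deterministic finite automaton, regarded as a blind automaton without counters. -/
def DFA.toBlindCounter {α : Type u} {Q : Type v} (M : DFA α Q) : BlindCounterAutomaton 0 α Q where
  start := M.start
  accept := M.accept
  δ q s := {t | ∃ a, s = some a ∧ t.1 = M.step q a}

theorem DFA.computationPath_toBlindCounter_iff {α : Type u} {Q : Type v} (M : DFA α Q)
    {x y : Q × (Fin 0 → ℤ)} {w : List α} :
    ComputationPath M.toBlindCounter.Step x w y ↔ M.evalFrom x.1 w = y.1 := by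
  constructor
  · intro h
    induction h with
    | nil c => rfl
    | cons hs _ ih =>
      obtain ⟨d, ⟨a, rfl, ha⟩, -⟩ := hs
      dsimp only at ha
      simpa [DFA.evalFrom_cons, ← ha] using ih
  · intro h
    induction w generalizing x with
    | nil =>
      obtain rfl : x = y := Prod.ext h (Subsingleton.elim _ _)
      exact .nil _
    | cons a w ih =>
      exact .cons (s := some a) (c' := (M.step x.1 a, x.2))
        ⟨fun _ => 0, ⟨a, rfl, rfl⟩, Subsingleton.elim _ _⟩ (ih h)

theorem Language.IsRegular.mem_blindCounterLanguages {α : Type u} {L : Language α}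
    (h : L.IsRegular) : L ∈ blindCounterLanguages 0 α := by
  obtain ⟨Q, _, M, rfl⟩ := h
  refine ⟨Q, inferInstance, M.toBlindCounter, ?_⟩
  ext w
  change (∃ q ∈ M.accept, ComputationPath M.toBlindCounter.Step (M.start, 0) w (q, 0)) ↔ _
  simp [DFA.computationPath_toBlindCounter_iff, DFA.mem_accepts, DFA.eval]

/-! ### Encoding vectors of natural numbers by prime powers -/

/-- The vector `f` encoded as the product of the powers `pᵢ ^ fᵢ`, where `pᵢ` is the `i`-th prime
number. -/
noncomputable def primeEncode {k : ℕ} (f : Fin k → ℕ) : ℕ :=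
  ∏ i : Fin k, Nat.nth Nat.Prime i ^ f i

theorem primeEncode_add {k : ℕ} (f g : Fin k → ℕ) :
    primeEncode (f + g) = primeEncode f * primeEncode g := by
  simp [primeEncode, pow_add, Finset.prod_mul_distrib]

theorem primeEncode_zero {k : ℕ} : primeEncode (0 : Fin k → ℕ) = 1 := by
  simp [primeEncode]

theorem primeEncode_injective {k : ℕ} :
    Function.Injective (primeEncode : (Fin k → ℕ) → ℕ) := by
  have key (f : Fin k → ℕ) (j : Fin k) :
      (primeEncode f).factorization (Nat.nth Nat.Prime j) = f j := by
    rw [primeEncode, Nat.factorization_prod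
      (fun (i : Fin k) _ => pow_ne_zero _ (Nat.prime_nth_prime i).ne_zero), Finsupp.finsetSum_apply]
    rw [Finset.sum_eq_single j]
    · simp
    · intro i _ hij
      have : Nat.nth Nat.Prime i ≠ Nat.nth Nat.Prime j := fun h =>
        hij (Fin.ext ((Nat.nth_strictMono Nat.infinite_setOfPred_prime).injective h))
      simp [this]
    · simp
  intro f g h
  funext j
  rw [← key f j, ← key g j, h]

/-! ### Simulating counters by integer matrices -/

theorem mem_integerMatrices {k : ℕ} {A : Matrix (Fin k) (Fin k) ℚ}
    (h : ∀ i j, ∃ z : ℤ, (z : ℚ) = A i j) : A ∈ integerMatrices k := by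
  choose B hB using h
  exact ⟨Matrix.of B, by ext i j; simpa using hB i j⟩

/-- The indicator vector of the counters on which the move `d` has sign `s`. -/
def signPart {k : ℕ} (s : SignType) (d : Fin k → SignType) (i : Fin k) : ℕ :=
  if d i = s then 1 else 0

theorem signType_cast_eq {k : ℕ} (d : Fin k → SignType) (i : Fin k) :
    ((d i : SignType) : ℤ) = signPart 1 d i - signPart (-1) d i := by
  unfold signPart
  generalize d i = s
  revert s
  decide

/-- Sends `(0, 0, 1)` to `(1, 1, 1)`, the code of vanishing counters. -/
def initMatrix : Matrix (Fin 3) (Fin 3) ℚ := !![0, 0, 0; 0, 0, 0; 1, 1, 1]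

/-- Sends `(x, y, z)` to `(x - y, 0, z)`. -/
def compareMatrix : Matrix (Fin 3) (Fin 3) ℚ := !![1, 0, 0; -1, 0, 0; 0, 0, 1]

/-- Multiplies the first entry by the primes of the incremented counters, and the second one by the
primes of the decremented counters. -/
noncomputable def countMatrix {k : ℕ} (d : Fin k → SignType) : Matrix (Fin 3) (Fin 3) ℚ :=
  Matrix.diagonal ![(primeEncode (signPart 1 d) : ℚ), (primeEncode (signPart (-1) d) : ℚ), 1]

/-- The row vector that encodes `a` increments and `b` decrements. -/
noncomputable def counterVector {k : ℕ} (a b : Fin k → ℕ) : Fin 3 → ℚ :=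
  ![(primeEncode a : ℚ), (primeEncode b : ℚ), 1]

theorem vecMul_initMatrix {k : ℕ} :
    Matrix.vecMul ![0, 0, 1] initMatrix = counterVector (0 : Fin k → ℕ) 0 := by
  ext i
  fin_cases i <;>
    simp [initMatrix, counterVector, primeEncode_zero, Matrix.vecMul, dotProduct, Fin.sum_univ_three]

theorem vecMul_countMatrix {k : ℕ} (a b : Fin k → ℕ) (d : Fin k → SignType) :
    Matrix.vecMul (counterVector a b) (countMatrix d) =
      counterVector (a + signPart 1 d) (b + signPart (-1) d) := by
  ext i
  rw [countMatrix, Matrix.vecMul_diagonal]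
  fin_cases i <;> simp [counterVector, primeEncode_add]

theorem vecMul_compareMatrix_eq_iff {k : ℕ} (a b : Fin k → ℕ) :
    ![0, 0, 1] = Matrix.vecMul (counterVector a b) compareMatrix ↔ a = b := by
  have : Matrix.vecMul (counterVector a b) compareMatrix =
      ![(primeEncode a : ℚ) - primeEncode b, 0, 1] := by
    ext i
    fin_cases i <;>
      simp [compareMatrix, counterVector, Matrix.vecMul, dotProduct, Fin.sum_univ_three,
        sub_eq_add_neg]
  rw [this, ← primeEncode_injective.eq_iff, ← Nat.cast_inj (R := ℚ)]
  constructor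
  · intro h
    exact sub_eq_zero.1 (congrFun h 0).symm
  · intro h
    rw [h, sub_self]

namespace BlindCounterAutomaton

variable {k : ℕ} {α : Type u} {Q : Type v} (V : BlindCounterAutomaton k α Q)

/-- The moves of the simulating automaton. Its states are those of `V`, a new initial state `none`
and a new accept state `some none`. It leaves `none` with an `ε`-move that encodes vanishing
counters, simulates `V`, and may go from any accept state of `V` to `some none` with an `ε`-move that
compares the two stored numbers. -/
def SimMove : Option (Option Q) → Option α → Option (Option Q) → Matrix (Fin 3) (Fin 3) ℚ → Prop
  | none, s, t, A => s = none ∧ t = some (some V.start) ∧ A = initMatrix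
  | some none, _, _, _ => False
  | some (some q), s, t, A =>
      (∃ q' d, (q', d) ∈ V.δ q s ∧ t = some (some q') ∧ A = countMatrix d) ∨
        (s = none ∧ q ∈ V.accept ∧ t = some none ∧ A = compareMatrix)

open Classical in
/-- The homing vector automaton that simulates the blind counter automaton `V`. -/
noncomputable def toHomingVector : BlindHomingVectorAutomaton 3 α (Option (Option Q)) where
  start := none
  accept := {some none}
  init := ![0, 0, 1]
  matrices := insert initMatrix (insert compareMatrix
    (Finset.univ.image fun d : Fin k → SignType => countMatrix d))
  δ q s := {t | V.SimMove q s t.1 t.2.1}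

theorem initMatrix_mem : initMatrix ∈ V.toHomingVector.matrices := by simp [toHomingVector]

theorem compareMatrix_mem : compareMatrix ∈ V.toHomingVector.matrices := by simp [toHomingVector]

theorem countMatrix_mem (d : Fin k → SignType) : countMatrix d ∈ V.toHomingVector.matrices := by
  simp [toHomingVector]

theorem matrices_subset_integerMatrices :
    ∀ A ∈ V.toHomingVector.matrices, A ∈ integerMatrices 3 := by
  intro A hA
  simp only [toHomingVector, Finset.mem_insert, Finset.mem_image, Finset.mem_univ, true_and] at hA
  obtain rfl | rfl | ⟨d, rfl⟩ := hA
  · exact mem_integerMatrices fun i j =>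
      ⟨!![0, 0, 0; 0, 0, 0; 1, 1, 1] i j, by fin_cases i <;> fin_cases j <;> simp [initMatrix]⟩
  · exact mem_integerMatrices fun i j =>
      ⟨!![1, 0, 0; -1, 0, 0; 0, 0, 1] i j,
        by fin_cases i <;> fin_cases j <;> simp [compareMatrix]⟩
  · exact mem_integerMatrices fun i j =>
      ⟨Matrix.diagonal
        ![(primeEncode (signPart 1 d) : ℤ), (primeEncode (signPart (-1) d) : ℤ), 1] i j,
        by fin_cases i <;> fin_cases j <;> simp [countMatrix]⟩

/-- The counter values after a move, in terms of the numbers of increments and decrements. -/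
theorem counter_step (a b : Fin k → ℕ) (d : Fin k → SignType) :
    (fun i => ((a i : ℤ) - b i) + (d i : ℤ)) =
      fun i => (((a + signPart 1 d) i : ℕ) : ℤ) - ((b + signPart (-1) d) i : ℕ) := by
  funext i
  rw [signType_cast_eq]
  simp only [Pi.add_apply]
  push_cast
  ring

/-- Computations of `V` are simulated on codes of pairs `a, b` whose difference is the vector of
counters. -/
theorem computationPath_toHomingVector {x y : Q × (Fin k → ℤ)} {w : List α}
    (h : ComputationPath V.Step x w y) (a b : Fin k → ℕ) (hx : x.2 = fun i => (a i : ℤ) - b i) :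
    ∃ a' b' : Fin k → ℕ, (y.2 = fun i => (a' i : ℤ) - b' i) ∧
      ComputationPath V.toHomingVector.Step (some (some x.1), counterVector a b) w
        (some (some y.1), counterVector a' b') := by
  induction h generalizing a b with
  | nil c => exact ⟨a, b, hx, .nil _⟩
  | @cons s c c' c'' w hs _ ih =>
    obtain ⟨d, hd, hc⟩ := hs
    obtain ⟨a', b', hy, hp⟩ := ih (a + signPart 1 d) (b + signPart (-1) d)
      (by rw [hc, hx, counter_step])
    exact ⟨a', b', hy, .cons ⟨⟨countMatrix d, V.countMatrix_mem d⟩,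
      Or.inl ⟨c'.1, d, hd, rfl, rfl⟩, (vecMul_countMatrix a b d).symm⟩ hp⟩

theorem eq_of_computationPath_from_final {v : Fin 3 → ℚ} {w : List α}
    {y : Option (Option Q) × (Fin 3 → ℚ)}
    (h : ComputationPath V.toHomingVector.Step (some none, v) w y) :
    w = [] ∧ y = (some none, v) := by
  cases h with
  | nil => exact ⟨rfl, rfl⟩
  | cons hs _ => obtain ⟨A, hA, -⟩ := hs; exact hA.elim

/-- Conversely, a computation of the simulating automaton from a code to the accepting configuration
is the code of an accepting computation of `V`: the homing condition forces the compared numbers to be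
equal, hence the counters to vanish. -/
theorem exists_accepting_of_computationPath {x y : Option (Option Q) × (Fin 3 → ℚ)} {w : List α}
    (h : ComputationPath V.toHomingVector.Step x w y) (hy : y = (some none, ![0, 0, 1]))
    (q : Q) (a b : Fin k → ℕ) (hx : x = (some (some q), counterVector a b)) :
    ∃ q' ∈ V.accept, ComputationPath V.Step (q, fun i => (a i : ℤ) - b i) w (q', 0) := by
  induction h generalizing q a b with
  | nil c => rw [hx] at hy; simp at hy
  | @cons s c c' c'' w hs hp ih =>
    subst hx
    obtain ⟨⟨A, hmem⟩, hA, hv⟩ := hs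
    obtain ⟨t, v⟩ := c'
    dsimp only at hA hv
    obtain ⟨q', d, hd, ht, hAd⟩ | ⟨rfl, hq, ht, hAd⟩ := hA
    · dsimp only at ht hAd
      subst ht hAd
      rw [vecMul_countMatrix] at hv
      obtain ⟨qf, hqf, hpath⟩ := ih hy q' _ _ (by rw [hv])
      refine ⟨qf, hqf, .cons ⟨d, hd, ?_⟩ hpath⟩
      exact (counter_step a b d).symm
    · dsimp only at ht hAd
      subst ht hAd
      obtain ⟨rfl, rfl⟩ := V.eq_of_computationPath_from_final hp
      have hv' : v = ![0, 0, 1] := congrArg Prod.snd hy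
      rw [hv', vecMul_compareMatrix_eq_iff] at hv
      subst hv
      refine ⟨q, hq, ?_⟩
      have : (fun i => (a i : ℤ) - a i) = 0 := by funext i; simp
      rw [this]
      exact .nil _

theorem language_toHomingVector : V.toHomingVector.language = V.language := by
  ext w
  constructor
  · rintro ⟨q, rfl, h⟩
    change ComputationPath V.toHomingVector.Step (none, ![0, 0, 1]) w (some none, ![0, 0, 1]) at h
    cases h with
    | @cons s _ c' _ w hs hp =>
      obtain ⟨⟨A, hmem⟩, ⟨rfl, ht, hA⟩, hv⟩ := hs
      obtain ⟨t, v⟩ := c'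
      dsimp only at ht hA hv
      subst ht hA
      rw [vecMul_initMatrix (k := k)] at hv
      obtain ⟨qf, hqf, h⟩ := V.exists_accepting_of_computationPath hp rfl V.start 0 0 (by rw [hv])
      refine ⟨qf, hqf, ?_⟩
      have : (fun i => (((0 : Fin k → ℕ) i : ℕ) : ℤ) - ((0 : Fin k → ℕ) i : ℕ)) = 0 := by
        funext i; simp
      rw [this] at h
      exact h
  · rintro ⟨q, hq, h⟩
    obtain ⟨a, b, hab, hp⟩ := V.computationPath_toHomingVector h 0 0 (by funext i; simp)
    have hab' : a = b := by
      funext i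
      have := congrFun hab i
      simp only [Pi.zero_apply] at this
      omega
    refine ⟨some none, rfl, ?_⟩
    have hstart : V.toHomingVector.Step none (none, ![0, 0, 1])
        (some (some V.start), counterVector (0 : Fin k → ℕ) 0) :=
      ⟨⟨initMatrix, V.initMatrix_mem⟩, ⟨rfl, rfl, rfl⟩, vecMul_initMatrix.symm⟩
    have hend : V.toHomingVector.Step none (some (some q), counterVector a b)
        (some none, ![0, 0, 1]) :=
      ⟨⟨compareMatrix, V.compareMatrix_mem⟩, Or.inr ⟨rfl, hq, rfl, rfl⟩,
        (vecMul_compareMatrix_eq_iff a b).2 hab'⟩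
    have hpath := ((ComputationPath.single hstart).append hp).append (.single hend)
    simp only [Option.toList_none, List.nil_append, List.append_nil] at hpath
    exact hpath

end BlindCounterAutomaton

theorem blindCounterLanguages_subset_blindHomingVectorLanguages (k : ℕ) (α : Type u) :
    blindCounterLanguages k α ⊆ blindHomingVectorLanguages 3 (integerMatrices 3) α := by
  rintro L ⟨Q, _, V, rfl⟩
  exact ⟨Option (Option Q), inferInstance, V.toHomingVector, V.matrices_subset_integerMatrices,
    V.language_toHomingVector⟩

/-! ### A homing vector automaton for `a ^ (n + 2 ^ n)` -/

/-- Doubles the first entry. -/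
def doubleMatrix : Matrix (Fin 3) (Fin 3) ℚ := Matrix.diagonal ![2, 1, 1]

/-- Subtracts the last entry from the first one. -/
def decrementMatrix : Matrix (Fin 3) (Fin 3) ℚ := !![1, 0, 0; 0, 1, 0; -1, 0, 1]

theorem vecMul_doubleMatrix (x : ℚ) :
    Matrix.vecMul ![x, 0, 1] doubleMatrix = ![2 * x, 0, 1] := by
  ext i
  rw [doubleMatrix, Matrix.vecMul_diagonal]
  fin_cases i <;> simp [mul_comm]

theorem vecMul_decrementMatrix (x : ℚ) :
    Matrix.vecMul ![x, 0, 1] decrementMatrix = ![x - 1, 0, 1] := by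
  ext i
  fin_cases i <;>
    simp [decrementMatrix, Matrix.vecMul, dotProduct, Fin.sum_univ_three, sub_eq_add_neg]

/-- The moves of `doublingAutomaton` on reading its letter: in state `false` the first entry is
doubled, or the state changes to `true` and the vector is kept; in state `true` the first entry is
decremented. -/
def DoublingMove : Bool → Bool → Matrix (Fin 3) (Fin 3) ℚ → Prop
  | false, false, A => A = doubleMatrix
  | false, true, A => A = 1
  | true, true, A => A = decrementMatrix
  | true, false, _ => False

/-- An automaton that recognizes `unaryPowLanguage a`. It starts with the vector `(1, 0, 1)`, doubles
the first entry `n` times, and decrements it `2 ^ n - 1` times. -/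
def doublingAutomaton {α : Type u} (a : α) : BlindHomingVectorAutomaton 3 α Bool where
  start := false
  accept := {true}
  init := ![1, 0, 1]
  matrices := {doubleMatrix, 1, decrementMatrix}
  δ q s := {t | s = some a ∧ DoublingMove q t.1 t.2.1}

section DoublingAutomaton

variable {α : Type u} (a : α)

theorem doublingAutomaton_double (x : ℚ) :
    (doublingAutomaton a).Step (some a) (false, ![x, 0, 1]) (false, ![2 * x, 0, 1]) :=
  ⟨⟨doubleMatrix, by simp [doublingAutomaton]⟩, ⟨rfl, rfl⟩, (vecMul_doubleMatrix x).symm⟩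

theorem doublingAutomaton_switch (x : ℚ) :
    (doublingAutomaton a).Step (some a) (false, ![x, 0, 1]) (true, ![x, 0, 1]) :=
  ⟨⟨1, by simp [doublingAutomaton]⟩, ⟨rfl, rfl⟩, (Matrix.vecMul_one _).symm⟩

theorem doublingAutomaton_decrement (x : ℚ) :
    (doublingAutomaton a).Step (some a) (true, ![x, 0, 1]) (true, ![x - 1, 0, 1]) :=
  ⟨⟨decrementMatrix, by simp [doublingAutomaton]⟩, ⟨rfl, rfl⟩, (vecMul_decrementMatrix x).symm⟩

theorem doublingAutomaton_path_double (n : ℕ) (x : ℚ) :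
    ComputationPath (doublingAutomaton a).Step (false, ![x, 0, 1]) (List.replicate n a)
      (false, ![2 ^ n * x, 0, 1]) := by
  induction n generalizing x with
  | zero => simpa using ComputationPath.nil _
  | succ n ih =>
    have h := ComputationPath.cons (doublingAutomaton_double a x) (ih (2 * x))
    rw [← mul_assoc, ← pow_succ] at h
    exact h

theorem doublingAutomaton_path_decrement (m : ℕ) (x : ℚ) :
    ComputationPath (doublingAutomaton a).Step (true, ![x, 0, 1]) (List.replicate m a)
      (true, ![x - m, 0, 1]) := by
  induction m generalizing x with
  | zero => simpa using ComputationPath.nil _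
  | succ m ih =>
    have h := ComputationPath.cons (doublingAutomaton_decrement a x) (ih (x - 1))
    have e : x - 1 - m = x - (m + 1 : ℕ) := by push_cast; ring
    rw [e] at h
    exact h

theorem eq_replicate_of_doublingAutomaton_true {y z : Bool × (Fin 3 → ℚ)} {w : List α}
    (h : ComputationPath (doublingAutomaton a).Step y w z) (hz : z = (true, ![1, 0, 1]))
    (x : ℚ) (hy : y = (true, ![x, 0, 1])) :
    ∃ m : ℕ, w = List.replicate m a ∧ x = m + 1 := by
  induction h generalizing x with
  | nil c =>
    rw [hy] at hz
    exact ⟨0, rfl, by simpa using congrFun (congrArg Prod.snd hz) 0⟩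
  | @cons s c c' c'' w hs _ ih =>
    subst hy
    obtain ⟨⟨A, hmem⟩, ⟨rfl, hA⟩, hv⟩ := hs
    obtain ⟨t, v⟩ := c'
    cases t with
    | false => exact hA.elim
    | true =>
      change A = decrementMatrix at hA
      subst hA
      obtain ⟨m, rfl, hx⟩ := ih hz (x - 1) (by rw [← vecMul_decrementMatrix x, ← hv])
      exact ⟨m + 1, rfl, by push_cast; linarith⟩

/-- A computation to the accepting configuration doubles `n` times, switches the state once, and
decrements `m` times, where `m` is determined by `n` through the homing condition. -/
theorem eq_replicate_of_doublingAutomaton_false {y z : Bool × (Fin 3 → ℚ)} {w : List α}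
    (h : ComputationPath (doublingAutomaton a).Step y w z) (hz : z = (true, ![1, 0, 1]))
    (x : ℚ) (hy : y = (false, ![x, 0, 1])) :
    ∃ n m : ℕ, w = List.replicate (n + 1 + m) a ∧ 2 ^ n * x = m + 1 := by
  induction h generalizing x with
  | nil c => rw [hy] at hz; simp at hz
  | @cons s c c' c'' w hs hp ih =>
    subst hy
    obtain ⟨⟨A, hmem⟩, ⟨rfl, hA⟩, hv⟩ := hs
    obtain ⟨t, v⟩ := c'
    cases t with
    | false =>
      change A = doubleMatrix at hA
      subst hA
      obtain ⟨n, m, rfl, hx⟩ := ih hz (2 * x) (by rw [← vecMul_doubleMatrix x, ← hv])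
      refine ⟨n + 1, m, ?_, by rw [← hx]; ring⟩
      rw [show n + 1 + 1 + m = n + 1 + m + 1 by omega]
      rfl
    | true =>
      change A = 1 at hA
      subst hA
      obtain ⟨m, rfl, hx⟩ := eq_replicate_of_doublingAutomaton_true a hp hz x
        (by rw [← Matrix.vecMul_one ![x, 0, 1], ← hv])
      refine ⟨0, m, ?_, by simpa using hx⟩
      rw [zero_add, add_comm]
      rfl

theorem language_doublingAutomaton : (doublingAutomaton a).language = unaryPowLanguage a := by
  ext w
  constructor
  · rintro ⟨q, rfl, h⟩
    obtain ⟨n, m, rfl, hm⟩ := eq_replicate_of_doublingAutomaton_false a h rfl 1 rfl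
    refine ⟨n, ?_⟩
    have : 2 ^ n = m + 1 := by
      rw [mul_one] at hm
      exact_mod_cast hm
    rw [this]
    congr 1
    omega
  · rintro ⟨n, rfl⟩
    refine ⟨true, rfl, ?_⟩
    obtain ⟨m, hm⟩ : ∃ m, 2 ^ n = m + 1 := Nat.exists_eq_succ_of_ne_zero (by positivity)
    have h := ((doublingAutomaton_path_double a n 1).append
      (.single (doublingAutomaton_switch a _))).append (doublingAutomaton_path_decrement a m _)
    have e : (2 ^ n * 1 - m : ℚ) = 1 := by
      have : (2 ^ n : ℚ) = m + 1 := by exact_mod_cast hm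
      rw [this]; ring
    rw [e] at h
    have hw : List.replicate n a ++ (some a).toList ++ List.replicate m a =
        List.replicate (n + 2 ^ n) a := by
      rw [hm, show (some a).toList = List.replicate 1 a from rfl, List.replicate_append_replicate,
        List.replicate_append_replicate]
      congr 1
      omega
    rw [hw] at h
    exact h

theorem unaryPowLanguage_mem_blindHomingVectorLanguages :
    unaryPowLanguage a ∈ blindHomingVectorLanguages 3 (integerMatrices 3) α := by
  refine ⟨Bool, inferInstance, doublingAutomaton a, fun A hA => ?_, language_doublingAutomaton a⟩
  simp only [doublingAutomaton, Finset.mem_insert, Finset.mem_singleton] at hA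
  obtain rfl | rfl | rfl := hA
  · exact mem_integerMatrices fun i j =>
      ⟨Matrix.diagonal ![2, 1, 1] i j,
        by fin_cases i <;> fin_cases j <;> simp [doubleMatrix]⟩
  · exact one_mem _
  · exact mem_integerMatrices fun i j =>
      ⟨!![1, 0, 0; 0, 1, 0; -1, 0, 1] i j,
        by fin_cases i <;> fin_cases j <;> simp [decrementMatrix]⟩

end DoublingAutomaton

/-! ### The strict inclusion -/

theorem mainTheorem3 (α : Type u) [Finite α] :
    ((⋃ k : ℕ, blindCounterLanguages k α) ⊆
      blindHomingVectorLanguages 3 (integerMatrices 3) α) ∧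
    (Nonempty α →
      (⋃ k : ℕ, blindCounterLanguages k α) ⊂
        blindHomingVectorLanguages 3 (integerMatrices 3) α) ∧
    (∀ a : α,
      ¬ (unaryPowLanguage a).IsRegular ∧
      unaryPowLanguage a ∈ blindHomingVectorLanguages 3 (integerMatrices 3) α ∧
      unaryPowLanguage a ∉ ⋃ k : ℕ, blindCounterLanguages k α) := by
  have hsub : (⋃ k : ℕ, blindCounterLanguages k α) ⊆
      blindHomingVectorLanguages 3 (integerMatrices 3) α :=
    Set.iUnion_subset fun k => blindCounterLanguages_subset_blindHomingVectorLanguages k α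
  have hnot (a : α) : unaryPowLanguage a ∉ ⋃ k : ℕ, blindCounterLanguages k α := by
    simpa using unaryPowLanguage_notMem_blindCounterLanguages a
  refine ⟨hsub, fun ⟨a⟩ => ?_, fun a => ⟨fun h => ?_, ?_, hnot a⟩⟩
  · exact ⟨hsub, fun h => hnot a (h (unaryPowLanguage_mem_blindHomingVectorLanguages a))⟩
  · exact unaryPowLanguage_notMem_blindCounterLanguages a 0 h.mem_blindCounterLanguages
  · exact unaryPowLanguage_mem_blindHomingVectorLanguages a
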